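/- Let $F$ be a field of characteristic $0$, let $n\ge 3$, and let $q=(q_{ij})$ be a multiplicatively antisymmetric $n\times n$ matrix over $F$, i.e. $q_{ij}\in F^*$, $q_{ii}=1$ and $q_{ji}=q_{ij}^{-1}$ for all $i,j$. Let $O_q=F\{X_1,\dots,X_n\}/\langle X_iX_j-q_{ij}X_jX_i : i<j\rangle$ be the associated quantum affine space. Write $\operatorname{Aut}_F(O_q)=(F^*)^n$ if the action of the torus $(F^*)^n$ on $O_q$ by the automorphisms $X_i\mapsto k_iX_i$ identifies $(F^*)^n$ with the whole group $\operatorname{Aut}_F(O_q)$ of $F$-algebra automorphisms. For $1\le i\le n$ put $$\Lambda_i=\Big\{\nu\in\mathbb N^n : \nu_i=0 \text{ and } \prod_k q_{kj}^{\nu_k}=q_{ij}\text{ for all } j\ne i\Big\},$$ where $0\in\mathbb N$, and for $\nu\in\Lambda_i$ let $D_{i\nu}$ be the $F$-linear derivation of $O_q$ with $D_{i\nu}(X_j)=\delta_{ij}X_1^{\nu_1}\cdots X_n^{\nu_n}$ for all $j$. Let $E=\sum_i\sum_{\nu\in\Lambda_i}O_qD_{i\nu}$, the left $O_q$-submodule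 of $\operatorname{End}_F(O_q)$ generated by all these derivations. For a permutation $\sigma$ let $m_\sigma$ denote its permutation matrix. Suppose that at most one of the entries $q_{ij}$ with $i<j$ equals $1$. (1) If no $q_{ij}$ with $i<j$ equals $1$, then $\operatorname{Aut}_F(O_q)=(F^*)^n$ if and only if (a) $E=0$, and (b) there is no non-identity permutation $\sigma$ of $\{1,\dots,n\}$ with $q\,m_\sigma=m_\sigma\,q$. (2) If exactly one of the entries $q_{ij}$ with $i<j$ equals $1$, say $q_{i'j'}=1$ with $i'<j'$, put $J=\{1,\dots,n\}\setminus\{i',j'\}$ and let $q'$ be the matrix obtained from $q$ by removing the rows and columns $i'$ and $j'$. Then $\operatorname{Aut}_F(O_q)=(F^*)^n$ if and only if (a) $E=0$, and (b) there do not exist a permutation $\pi_1$ of $\{i',j'\}$ and a non-identity permutation $\pi_2$ of $J$ such that $q_{i'r}=q_{\pi_1(i')\pi_2(r)}$ and $q_{j'r}=q_{\pi_1(j')\pi_2(r)}$ for all $r\in J$, and $q'\,m_{\pi_2}=m_{\pi_2}\,q'$. -/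

import Mathlib

namespace QuantumAffine

variable {F : Type*} [Field F] {n : ℕ}

/-- A multiplicatively antisymmetric matrix with entries in `F*`. -/
structure IsMultAntisymm (q : Matrix (Fin n) (Fin n) F) : Prop where
  ne_zero : ∀ i j, q i j ≠ 0
  diag : ∀ i, q i i = 1
  symm_inv : ∀ i j, q j i = (q i j)⁻¹

/-- The defining relations `X_i X_j = q_ij X_j X_i` (`i < j`) on the free algebra. -/
inductive Rel (q : Matrix (Fin n) (Fin n) F) :
    FreeAlgebra F (Fin n) → FreeAlgebra F (Fin n) → Prop
  | comm (i j : Fin n) (hij : i < j) :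
      Rel q (FreeAlgebra.ι F i * FreeAlgebra.ι F j)
        (q i j • (FreeAlgebra.ι F j * FreeAlgebra.ι F i))

/-- The quantum affine space `O_q`: the quotient of the free algebra `F{X_1, …, X_n}` by the
two-sided ideal generated by the `X_i X_j - q_ij X_j X_i`, `i < j`. -/
abbrev Space (q : Matrix (Fin n) (Fin n) F) : Type _ := RingQuot (Rel q)

/-- The generator `X_i` of `O_q`. -/
noncomputable def X (q : Matrix (Fin n) (Fin n) F) (i : Fin n) : Space q :=
  RingQuot.mkAlgHom F (Rel q) (FreeAlgebra.ι F i)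

theorem X_mul_X (q : Matrix (Fin n) (Fin n) F) (i j : Fin n) (hij : i < j) :
    X q i * X q j = q i j • (X q j * X q i) := by
  have h := RingQuot.mkAlgHom_rel F (Rel.comm (q := q) i j hij)
  simp only [map_mul, map_smul] at h
  exact h

theorem algHom_ext {q : Matrix (Fin n) (Fin n) F} {A : Type*} [Semiring A] [Algebra F A]
    {f g : Space q →ₐ[F] A} (h : ∀ i, f (X q i) = g (X q i)) : f = g := by
  apply RingQuot.ringQuot_ext'
  apply FreeAlgebra.hom_ext
  funext i
  exact h i

/-- The endomorphism `X_i ↦ k_i X_i` of `O_q`. -/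
noncomputable def scale (q : Matrix (Fin n) (Fin n) F) (k : Fin n → Fˣ) :
    Space q →ₐ[F] Space q :=
  RingQuot.liftAlgHom F ⟨FreeAlgebra.lift F (fun i => (k i : F) • X q i), by
    rintro _ _ ⟨i, j, hij⟩
    simp only [map_mul, map_smul, FreeAlgebra.lift_ι_apply, smul_mul_smul_comm,
      X_mul_X q i j hij, smul_smul]
    congr 1
    ring⟩

theorem scale_X (q : Matrix (Fin n) (Fin n) F) (k : Fin n → Fˣ) (i : Fin n) :
    scale q k (X q i) = (k i : F) • X q i := by
  simp [scale, X]

theorem scale_comp (q : Matrix (Fin n) (Fin n) F) (k l : Fin n → Fˣ) :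
    (scale q k).comp (scale q l) = scale q (k * l) := by
  apply algHom_ext
  intro i
  simp [scale_X, smul_smul, mul_comm]

theorem scale_one (q : Matrix (Fin n) (Fin n) F) :
    scale q 1 = AlgHom.id F (Space q) := by
  apply algHom_ext
  intro i
  simp [scale_X]

/-- The torus `(F*)^n` acting on `O_q` by the automorphisms `X_i ↦ k_i X_i`. -/
noncomputable def torusHom (q : Matrix (Fin n) (Fin n) F) :
    (Fin n → Fˣ) →* (Space q ≃ₐ[F] Space q) where
  toFun k := AlgEquiv.ofAlgHom (scale q k) (scale q k⁻¹)
    (by rw [scale_comp, mul_inv_cancel, scale_one])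
    (by rw [scale_comp, inv_mul_cancel, scale_one])
  map_one' := by
    ext x
    simp [scale_one]
  map_mul' k l := by
    ext x
    simp [← scale_comp]

/-- `Aut_F(O_q) = (F*)^n`: every `F`-algebra automorphism has the form `X_i ↦ k_i X_i` for exactly
one `k` in the torus. -/
def AutEqTorus (q : Matrix (Fin n) (Fin n) F) : Prop :=
  Function.Bijective (torusHom q)

/-- The monomial `x^ν = X_1^{ν_1} ⋯ X_n^{ν_n}`, the factors in increasing order of the index. -/
noncomputable def monom (q : Matrix (Fin n) (Fin n) F) (ν : Fin n → ℕ) : Space q :=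
  (List.ofFn fun i => X q i ^ ν i).prod

/-- The set `Λ_i` of exponents. -/
def Lam (q : Matrix (Fin n) (Fin n) F) (i : Fin n) : Set (Fin n → ℕ) :=
  {ν | ν i = 0 ∧ ∀ j, j ≠ i → ∏ k, q k j ^ ν k = q i j}

/-- An `F`-linear derivation of the (noncommutative) algebra `O_q`. -/
def IsDerivation (q : Matrix (Fin n) (Fin n) F) (D : Space q →ₗ[F] Space q) : Prop :=
  ∀ a b, D (a * b) = D a * b + a * D b

/-- `D` is the derivation `D_{iν}`, determined by `D_{iν}(X_j) = δ_ij x^ν`. -/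
def IsD (q : Matrix (Fin n) (Fin n) F) (i : Fin n) (ν : Fin n → ℕ)
    (D : Space q →ₗ[F] Space q) : Prop :=
  IsDerivation q D ∧ ∀ j, D (X q j) = if i = j then monom q ν else 0

/-- `E = ∑_i ∑_{ν ∈ Λ_i} O_q D_{iν}`. As left multiples of a derivation by noncentral elements need
not be derivations, the sum is formed in the left `O_q`-module of all `F`-linear
endomorphisms of `O_q`. -/
noncomputable def E (q : Matrix (Fin n) (Fin n) F) :
    Submodule (Space q) (Space q →ₗ[F] Space q) :=
  Submodule.span (Space q) {D | ∃ i, ∃ ν ∈ Lam q i, IsD q i ν D}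

end QuantumAffine

namespace QuantumAffine

variable {F : Type*} [Field F] {n : ℕ}

/-! The ordered monomials form a basis of `O_q` (`linearIndependent_monom`, `span_monom`). Products
of monomials are nonzero multiples of monomials, so lexicographically extreme exponents add. Hence
`O_q` is a domain whose units are scalars, and if `f * X_j = g * f` with `f ≠ 0`, then `g` is a
multiple of `X_j`. All exponents of a normal element `f` thus have the same commutation factor with
each `X_j` (`prod_eq_of_mem_support`).

Let `φ` be an automorphism. Since `X_i` is normal, so is `φ(X_i)`, and it has a linear term in some
`X_a` (`exists_single_mem_support`). Each exponent of `φ(X_i)` then commutes with the generators as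
`X_a` does, so one not involving `X_a` would lie in `Λ_a`. If `E = 0`, every `Λ_a` is empty and
`X_a` divides `φ(X_i)`. The same argument for `φ⁻¹` makes the cofactor a scalar, so `φ` permutes the
generators up to scalars and the permutation preserves `q`.

Conversely, an exponent in `Λ_i` gives an elementary automorphism and a permutation preserving `q`
gives a permutation automorphism; neither is in the torus unless the permutation is trivial. This
proves `autEqTorus_iff`; both parts of the theorem are then combinatorics of permutations. -/

/-- `a` and `b` commute up to a nonzero scalar. -/
def QuasiCommute {A : Type*} [Ring A] [Algebra F A] (a b : A) : Prop :=
  ∃ c : F, c ≠ 0 ∧ a * b = c • (b * a)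

/-! ### Products of elements commuting up to scalars -/

namespace QuasiCommute

variable {A : Type*} [Ring A] [Algebra F A] {a b d : A}

theorem one_right : QuasiCommute (F := F) a 1 := ⟨1, one_ne_zero, by simp⟩

theorem symm (h : QuasiCommute (F := F) a b) : QuasiCommute (F := F) b a := by
  obtain ⟨c, hc, h⟩ := h
  exact ⟨c⁻¹, inv_ne_zero hc, by rw [h, smul_smul, inv_mul_cancel₀ hc, one_smul]⟩

theorem mul_right (hb : QuasiCommute (F := F) a b) (hd : QuasiCommute (F := F) a d) :
    QuasiCommute (F := F) a (b * d) := by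
  obtain ⟨c, hc, h⟩ := hb
  obtain ⟨c', hc', h'⟩ := hd
  refine ⟨c * c', mul_ne_zero hc hc', ?_⟩
  rw [← mul_assoc, h, smul_mul_assoc, mul_assoc, h', mul_smul_comm, smul_smul, mul_assoc]

theorem pow_right (h : QuasiCommute (F := F) a b) (k : ℕ) :
    QuasiCommute (F := F) a (b ^ k) := by
  induction k with
  | zero => simpa using one_right
  | succ k ih => rw [pow_succ]; exact ih.mul_right h

theorem list_prod_right (l : List A) (h : ∀ b ∈ l, QuasiCommute (F := F) a b) :
    QuasiCommute (F := F) a l.prod := by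
  induction l with
  | nil => simpa using one_right
  | cons b l ih =>
    rw [List.prod_cons]
    exact (h b (by simp)).mul_right (ih fun b' hb' => h b' (by simp [hb']))

/-- Moving `z 0` to the left past the tail of the `y`'s costs only a nonzero scalar; then induct. -/
theorem prod_ofFn_mul {m : ℕ} (y z : Fin m → A)
    (h : ∀ i j, QuasiCommute (F := F) (y i) (z j)) :
    ∃ c : F, c ≠ 0 ∧ (List.ofFn y).prod * (List.ofFn z).prod =
      c • (List.ofFn fun i => y i * z i).prod := by
  induction m with
  | zero => exact ⟨1, one_ne_zero, by simp⟩
  | succ m ih =>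
    obtain ⟨c, hc, e⟩ := ih (fun i => y i.succ) (fun i => z i.succ) fun i j => h _ _
    obtain ⟨c', hc', e'⟩ : QuasiCommute (F := F) (List.ofFn fun i => y (Fin.succ i)).prod (z 0) := by
      refine (list_prod_right _ ?_).symm
      intro b hb
      obtain ⟨i, rfl⟩ := (List.mem_ofFn' _ _).1 hb
      exact (h _ _).symm
    refine ⟨c' * c, mul_ne_zero hc' hc, ?_⟩
    simp only [List.ofFn_succ, List.prod_cons]
    calc _ = y 0 * ((List.ofFn fun i => y (Fin.succ i)).prod * z 0)
          * (List.ofFn fun i => z (Fin.succ i)).prod := by simp only [mul_assoc]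
      _ = c' • (y 0 * z 0 * ((List.ofFn fun i => y (Fin.succ i)).prod
          * (List.ofFn fun i => z (Fin.succ i)).prod)) := by
        rw [e']; simp only [mul_assoc, mul_smul_comm, smul_mul_assoc]
      _ = _ := by rw [e, mul_smul_comm, smul_smul]

end QuasiCommute

theorem list_prod_ofFn_ite {A : Type*} [Monoid A] {m : ℕ} (i : Fin m) (x : A) :
    (List.ofFn fun j => if j = i then x else 1).prod = x := by
  induction m with
  | zero => exact i.elim0
  | succ m ih =>
    rw [List.ofFn_succ, List.prod_cons]
    refine Fin.cases ?_ (fun i => ?_) i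
    · simp [Fin.succ_ne_zero]
    · simpa [(Fin.succ_ne_zero i).symm] using ih i

/-! ### The basis of ordered monomials -/

variable {q : Matrix (Fin n) (Fin n) F}

theorem IsMultAntisymm.X_mul_X (hq : IsMultAntisymm q) (i j : Fin n) :
    X q i * X q j = q i j • (X q j * X q i) := by
  rcases lt_trichotomy i j with h | rfl | h
  · exact QuantumAffine.X_mul_X q i j h
  · simp [hq.diag]
  · rw [QuantumAffine.X_mul_X q j i h, smul_smul, hq.symm_inv j i, inv_mul_cancel₀ (hq.ne_zero _ _),
      one_smul]

/-- The algebra homomorphism given by elements satisfying the defining relations. -/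
noncomputable def lift {A : Type*} [Ring A] [Algebra F A] (q : Matrix (Fin n) (Fin n) F)
    (y : Fin n → A) (h : ∀ i j, i < j → y i * y j = q i j • (y j * y i)) : Space q →ₐ[F] A :=
  RingQuot.liftAlgHom F ⟨FreeAlgebra.lift F y, by
    rintro _ _ ⟨i, j, hij⟩
    simpa only [map_mul, map_smul, FreeAlgebra.lift_ι_apply] using h i j hij⟩

@[simp] theorem lift_X {A : Type*} [Ring A] [Algebra F A] (y : Fin n → A)
    (h : ∀ i j, i < j → y i * y j = q i j • (y j * y i)) (i : Fin n) :
    lift q y h (X q i) = y i := by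
  simp [lift, X]

theorem space_induction (p : Submodule F (Space q)) (h1 : 1 ∈ p)
    (hX : ∀ i, ∀ a ∈ p, X q i * a ∈ p) (a : Space q) : a ∈ p := by
  obtain ⟨a, rfl⟩ := RingQuot.mkAlgHom_surjective F (Rel q) a
  -- Only left multiplication by generators is available, so the induction on `a` is carried out for
  -- `a * b` with `b ∈ p` arbitrary.
  have key : ∀ b ∈ p, RingQuot.mkAlgHom F (Rel q) a * b ∈ p := by
    induction a using FreeAlgebra.induction with
    | grade0 r =>
      intro b hb
      rw [AlgHom.commutes, ← Algebra.smul_def]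
      exact p.smul_mem _ hb
    | grade1 i => exact hX i
    | mul a b iha ihb =>
      intro c hc
      rw [map_mul, mul_assoc]
      exact iha _ (ihb _ hc)
    | add a b iha ihb =>
      intro c hc
      rw [map_add, add_mul]
      exact p.add_mem (iha _ hc) (ihb _ hc)
  simpa using key 1 h1

theorem monom_zero : monom q 0 = 1 := by
  simp [monom]

theorem monom_single (i : Fin n) : monom q (Pi.single i 1) = X q i := by
  have h : (fun j => X q j ^ (Pi.single i 1 : Fin n → ℕ) j) =
      fun j => if j = i then X q i else 1 := by
    funext j
    by_cases h : j = i
    · subst h; simp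
    · simp [h]
  rw [monom, h, list_prod_ofFn_ite]

theorem monom_mul_monom (hq : IsMultAntisymm q) (μ ν : Fin n → ℕ) :
    ∃ c : F, c ≠ 0 ∧ monom q μ * monom q ν = c • monom q (μ + ν) := by
  simp only [monom, Pi.add_apply, pow_add]
  apply QuasiCommute.prod_ofFn_mul
  intro i j
  exact ((QuasiCommute.pow_right ⟨_, hq.ne_zero i j, hq.X_mul_X i j⟩ _).symm.pow_right _).symm

theorem span_monom (hq : IsMultAntisymm q) : Submodule.span F (Set.range (monom q)) = ⊤ := by
  rw [eq_top_iff]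
  rintro a -
  refine space_induction _ ?_ ?_ a
  · exact Submodule.subset_span ⟨0, monom_zero⟩
  · intro i a ha
    induction ha using Submodule.span_induction with
    | mem x hx =>
      obtain ⟨ν, rfl⟩ := hx
      obtain ⟨c, -, h⟩ := monom_mul_monom hq (Pi.single i 1) ν
      rw [← monom_single, h]
      exact Submodule.smul_mem _ _ (Submodule.subset_span ⟨_, rfl⟩)
    | zero => simp
    | add x y _ _ hx hy => rw [mul_add]; exact Submodule.add_mem _ hx hy
    | smul c x _ hx => rw [mul_smul_comm]; exact Submodule.smul_mem _ _ hx

/-- The operator by which `X_i` acts on the space with basis the exponents. -/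
noncomputable def shift (q : Matrix (Fin n) (Fin n) F) (i : Fin n) :
    Module.End F ((Fin n → ℕ) →₀ F) :=
  Finsupp.lsum F fun ν =>
    -- This is left multiplication by `X_i` on ordered monomials: the scalar arises from moving
    -- `X_i` past the powers of the `X_j` with `j < i`.
    (∏ j ∈ Finset.univ.filter (· < i), q i j ^ ν j) • Finsupp.lsingle (ν + Pi.single i 1)

theorem shift_single (i : Fin n) (ν : Fin n → ℕ) (c : F) :
    shift q i (Finsupp.single ν c) =
      Finsupp.single (ν + Pi.single i 1)
        ((∏ j ∈ Finset.univ.filter (· < i), q i j ^ ν j) * c) := by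
  simp [shift]

theorem shift_mul_shift (hq : IsMultAntisymm q) (i j : Fin n) (hij : i < j) :
    shift q i * shift q j = q i j • (shift q j * shift q i) := by
  refine Finsupp.lhom_ext fun ν c => ?_
  simp only [Module.End.mul_apply, LinearMap.smul_apply, shift_single, Finsupp.smul_single]
  rw [add_right_comm]
  congr 1
  have h1 : ∏ k ∈ Finset.univ.filter (· < i), q i k ^ (ν + Pi.single j 1 : Fin n → ℕ) k
      = ∏ k ∈ Finset.univ.filter (· < i), q i k ^ ν k := by
    refine Finset.prod_congr rfl fun k hk => ?_
    have : k ≠ j := ((Finset.mem_filter.1 hk).2.trans hij).ne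
    simp [this]
  have h2 : ∏ k ∈ Finset.univ.filter (· < j), q j k ^ (ν + Pi.single i 1 : Fin n → ℕ) k
      = q j i * ∏ k ∈ Finset.univ.filter (· < j), q j k ^ ν k := by
    simp only [Pi.add_apply, pow_add, Finset.prod_mul_distrib]
    rw [mul_comm]
    congr 1
    rw [Finset.prod_eq_single i]
    · simp
    · intro k _ hk; simp [hk]
    · intro h; simp [hij] at h
  rw [h1, h2, hq.symm_inv i j, smul_eq_mul]
  have := hq.ne_zero i j
  field_simp

/-- The representation of `O_q` on the space with basis the exponents. -/
noncomputable def rep (hq : IsMultAntisymm q) : Space q →ₐ[F] Module.End F ((Fin n → ℕ) →₀ F) :=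
  lift q (shift q) (shift_mul_shift hq)

theorem rep_X_pow_single (hq : IsMultAntisymm q) (i : Fin n) (k : ℕ) (ν : Fin n → ℕ) (c : F)
    (hc : c ≠ 0) : ∃ c' : F, c' ≠ 0 ∧ rep hq (X q i ^ k) (Finsupp.single ν c) =
      Finsupp.single (ν + Pi.single i k) c' := by
  induction k generalizing ν c with
  | zero => exact ⟨c, hc, by simp⟩
  | succ k ih =>
    rw [pow_succ, map_mul, Module.End.mul_apply]
    have h : rep hq (X q i) = shift q i := by simp [rep]
    rw [h, shift_single]
    obtain ⟨c', hc', e⟩ := ih (ν + Pi.single i 1)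
      ((∏ j ∈ Finset.univ.filter (· < i), q i j ^ ν j) * c)
      (mul_ne_zero (Finset.prod_ne_zero_iff.2 fun j _ => pow_ne_zero _ (hq.ne_zero _ _)) hc)
    exact ⟨c', hc', by rw [e, add_assoc, ← Pi.single_add, add_comm 1 k]⟩

theorem rep_list_prod_single (hq : IsMultAntisymm q) (ν : Fin n → ℕ) (l : List (Fin n)) :
    ∃ c : F, c ≠ 0 ∧ rep hq (l.map fun i => X q i ^ ν i).prod (Finsupp.single 0 1) =
      Finsupp.single (l.map fun i => (Pi.single i (ν i) : Fin n → ℕ)).sum c := by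
  induction l with
  | nil => exact ⟨1, one_ne_zero, by simp⟩
  | cons i l ih =>
    obtain ⟨c, hc, e⟩ := ih
    obtain ⟨c', hc', e'⟩ := rep_X_pow_single hq i (ν i)
      (l.map fun i => (Pi.single i (ν i) : Fin n → ℕ)).sum c hc
    refine ⟨c', hc', ?_⟩
    rw [List.map_cons, List.prod_cons, map_mul, Module.End.mul_apply, e, e', List.map_cons,
      List.sum_cons, add_comm]

theorem rep_monom (hq : IsMultAntisymm q) (ν : Fin n → ℕ) :
    ∃ c : F, c ≠ 0 ∧ rep hq (monom q ν) (Finsupp.single 0 1) = Finsupp.single ν c := by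
  obtain ⟨c, hc, e⟩ := rep_list_prod_single hq ν (List.finRange n)
  refine ⟨c, hc, ?_⟩
  rw [monom, List.ofFn_eq_map, e, ← List.ofFn_eq_map, List.sum_ofFn, Finset.univ_sum_single]

/-- Applied to the basis vector at exponent `0`, `x^ν` gives a nonzero multiple of the basis vector
at `ν`, so a linear dependence among monomials would be one among basis vectors. -/
theorem linearIndependent_monom (hq : IsMultAntisymm q) : LinearIndependent F (monom q) := by
  choose c hc e using rep_monom hq
  refine LinearIndependent.of_comp
    ((LinearMap.applyₗ (Finsupp.single 0 1)).comp (rep hq).toLinearMap) ?_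
  have h : (⇑((LinearMap.applyₗ (Finsupp.single 0 1)).comp (rep hq).toLinearMap) ∘ monom q) =
      (fun ν => Units.mk0 (c ν) (hc ν)) • fun ν : Fin n → ℕ => Finsupp.single ν (1 : F) := by
    funext ν
    simp [e, Units.smul_def]
  rw [h]
  exact (Finsupp.linearIndependent_single_one F (Fin n → ℕ)).units_smul _

/-- The ordered monomials form a basis of quantum affine space. -/
noncomputable def monomBasis (hq : IsMultAntisymm q) : Module.Basis (Fin n → ℕ) F (Space q) :=
  .mk (linearIndependent_monom hq) (span_monom hq).ge

@[simp] theorem monomBasis_apply (hq : IsMultAntisymm q) (ν : Fin n → ℕ) :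
    monomBasis hq ν = monom q ν := by
  simp [monomBasis]

theorem repr_monom (hq : IsMultAntisymm q) (ν : Fin n → ℕ) :
    (monomBasis hq).repr (monom q ν) = Finsupp.single ν 1 := by
  rw [← monomBasis_apply hq, Module.Basis.repr_self]

theorem repr_X (hq : IsMultAntisymm q) (i : Fin n) :
    (monomBasis hq).repr (X q i) = Finsupp.single (Pi.single i 1) 1 := by
  rw [← monom_single, repr_monom]

theorem repr_one (hq : IsMultAntisymm q) :
    (monomBasis hq).repr 1 = Finsupp.single 0 1 := by
  rw [← monom_zero, repr_monom]

/-! ### Supports of products and the lexicographic order -/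

theorem exists_repr_mul (hq : IsMultAntisymm q) : ∃ c : (Fin n → ℕ) → (Fin n → ℕ) → F,
    (∀ μ ν, c μ ν ≠ 0) ∧ ∀ a b κ, (monomBasis hq).repr (a * b) κ =
      ∑ μ ∈ ((monomBasis hq).repr a).support, ∑ ν ∈ ((monomBasis hq).repr b).support,
        if μ + ν = κ then (monomBasis hq).repr a μ * (monomBasis hq).repr b ν * c μ ν else 0 := by
  choose c hc e using monom_mul_monom hq
  refine ⟨c, hc, fun a b κ => ?_⟩
  have ha := (monomBasis hq).linearCombination_repr a
  have hb := (monomBasis hq).linearCombination_repr b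
  rw [Finsupp.linearCombination_apply, Finsupp.sum] at ha hb
  conv_lhs => rw [← ha, ← hb]
  simp only [monomBasis_apply, Finset.sum_mul_sum, smul_mul_smul_comm, e, smul_smul, map_sum,
    map_smul, repr_monom, Finsupp.finsetSum_apply, Finsupp.smul_apply, Finsupp.single_apply,
    smul_eq_mul, mul_ite, mul_one, mul_zero]

theorem exists_add_of_mem_support_mul (hq : IsMultAntisymm q) {a b : Space q} {κ : Fin n → ℕ}
    (h : κ ∈ ((monomBasis hq).repr (a * b)).support) :
    ∃ μ ∈ ((monomBasis hq).repr a).support, ∃ ν ∈ ((monomBasis hq).repr b).support,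
      μ + ν = κ := by
  obtain ⟨c, -, e⟩ := exists_repr_mul hq
  rw [Finsupp.mem_support_iff, e] at h
  obtain ⟨μ, hμ, h⟩ := Finset.exists_ne_zero_of_sum_ne_zero h
  obtain ⟨ν, hν, h⟩ := Finset.exists_ne_zero_of_sum_ne_zero h
  exact ⟨μ, hμ, ν, hν, by_contra fun h' => h (if_neg h')⟩

/-- A sum of exponents attained in only one way cannot cancel, because the structure constants are
nonzero. -/
theorem add_mem_support_mul (hq : IsMultAntisymm q) {a b : Space q} {μ ν : Fin n → ℕ}
    (hμ : μ ∈ ((monomBasis hq).repr a).support) (hν : ν ∈ ((monomBasis hq).repr b).support)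
    (h : UniqueAdd ((monomBasis hq).repr a).support ((monomBasis hq).repr b).support μ ν) :
    μ + ν ∈ ((monomBasis hq).repr (a * b)).support := by
  obtain ⟨c, hc, e⟩ := exists_repr_mul hq
  rw [Finsupp.mem_support_iff, e, Finset.sum_eq_single μ, Finset.sum_eq_single ν, if_pos rfl]
  · exact mul_ne_zero (mul_ne_zero (Finsupp.mem_support_iff.1 hμ) (Finsupp.mem_support_iff.1 hν))
      (hc _ _)
  · exact fun ν' _ hne => if_neg fun h' => hne (add_left_cancel h')
  · exact fun h' => absurd hν h'
  · exact fun μ' hμ' hne => Finset.sum_eq_zero fun ν' hν' => if_neg fun h' =>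
      hne (h hμ' hν' h').1
  · exact fun h' => absurd hμ h'

/-- `μ` is the lexicographically largest exponent of `a`. -/
def IsTop (hq : IsMultAntisymm q) (a : Space q) (μ : Fin n → ℕ) : Prop :=
  μ ∈ ((monomBasis hq).repr a).support ∧
    ∀ ν ∈ ((monomBasis hq).repr a).support, toLex ν ≤ toLex μ

/-- `μ` is the lexicographically smallest exponent of `a`. -/
def IsBot (hq : IsMultAntisymm q) (a : Space q) (μ : Fin n → ℕ) : Prop :=
  μ ∈ ((monomBasis hq).repr a).support ∧
    ∀ ν ∈ ((monomBasis hq).repr a).support, toLex μ ≤ toLex ν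

theorem support_nonempty (hq : IsMultAntisymm q) {a : Space q} (ha : a ≠ 0) :
    ((monomBasis hq).repr a).support.Nonempty := by
  simpa using ha

theorem exists_isTop (hq : IsMultAntisymm q) {a : Space q} (ha : a ≠ 0) :
    ∃ μ, IsTop hq a μ :=
  Finset.exists_max_image _ toLex (support_nonempty hq ha)

theorem exists_isBot (hq : IsMultAntisymm q) {a : Space q} (ha : a ≠ 0) :
    ∃ μ, IsBot hq a μ :=
  Finset.exists_min_image _ toLex (support_nonempty hq ha)

theorem IsTop.add_mem (hq : IsMultAntisymm q) {a b : Space q} {μ ν : Fin n → ℕ}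
    (ha : IsTop hq a μ) (hb : IsTop hq b ν) :
    μ + ν ∈ ((monomBasis hq).repr (a * b)).support := by
  refine add_mem_support_mul hq ha.1 hb.1 fun μ' ν' hμ' hν' h => ?_
  have := (add_eq_add_iff_eq_and_eq (ha.2 _ hμ') (hb.2 _ hν')).1 (by
    rw [← toLex_add, h, toLex_add])
  exact ⟨toLex.injective this.1, toLex.injective this.2⟩

theorem IsBot.add_mem (hq : IsMultAntisymm q) {a b : Space q} {μ ν : Fin n → ℕ}
    (ha : IsBot hq a μ) (hb : IsBot hq b ν) :
    μ + ν ∈ ((monomBasis hq).repr (a * b)).support := by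
  refine add_mem_support_mul hq ha.1 hb.1 fun μ' ν' hμ' hν' h => ?_
  have := (add_eq_add_iff_eq_and_eq (ha.2 _ hμ') (hb.2 _ hν')).1 (by
    rw [← toLex_add, ← h, toLex_add])
  exact ⟨toLex.injective this.1.symm, toLex.injective this.2.symm⟩

/-- Quantum affine space has no zero divisors. -/
theorem mul_ne_zero_of_ne_zero (hq : IsMultAntisymm q) {a b : Space q} (ha : a ≠ 0) (hb : b ≠ 0) :
    a * b ≠ 0 := by
  obtain ⟨μ, hμ⟩ := exists_isTop hq ha
  obtain ⟨ν, hν⟩ := exists_isTop hq hb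
  intro h
  simpa [h] using hμ.add_mem hq hν

theorem X_ne_zero (hq : IsMultAntisymm q) (i : Fin n) : X q i ≠ 0 := by
  rw [← monom_single]
  exact (linearIndependent_monom hq).ne_zero _

theorem nontrivial_space (hq : IsMultAntisymm q) : Nontrivial (Space q) :=
  ⟨⟨1, 0, by rw [← monom_zero]; exact (linearIndependent_monom hq).ne_zero _⟩⟩

theorem eq_smul_monom_of_support (hq : IsMultAntisymm q) {a : Space q} {μ : Fin n → ℕ}
    (h : ∀ ν ∈ ((monomBasis hq).repr a).support, ν = μ) :
    a = (monomBasis hq).repr a μ • monom q μ := by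
  apply (monomBasis hq).repr.injective
  rw [map_smul, repr_monom, Finsupp.smul_single, smul_eq_mul, mul_one]
  exact Finsupp.support_subset_singleton.1 fun ν hν => Finset.mem_singleton.2 (h ν hν)

/-- The one-sided units of quantum affine space are scalars. -/
theorem eq_smul_one_of_mul_eq_one (hq : IsMultAntisymm q) {u v : Space q} (h : u * v = 1) :
    ∃ c : F, u = c • 1 := by
  have := nontrivial_space hq
  obtain ⟨μ, hμ⟩ := exists_isTop hq (left_ne_zero_of_mul_eq_one h)
  obtain ⟨ν, hν⟩ := exists_isTop hq (right_ne_zero_of_mul_eq_one h)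
  have hs := hμ.add_mem hq hν
  rw [h, repr_one] at hs
  have h0 : μ + ν = 0 := by simpa using Finsupp.support_single_subset hs
  have hμ0 : μ = 0 := by
    funext i
    have := congrFun h0 i
    simp only [Pi.add_apply, Pi.zero_apply] at this ⊢
    omega
  -- Zero is the lexicographically least exponent, so if it is also the top exponent of `u`, it is
  -- the only one.
  refine ⟨_, (eq_smul_monom_of_support hq (μ := 0) fun κ hκ => ?_).trans (by rw [monom_zero])⟩
  have h1 := hμ.2 κ hκ
  rw [hμ0] at h1
  exact toLex.injective (le_antisymm h1 (Pi.toLex_monotone (fun i => Nat.zero_le (κ i))))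

/-! ### Commutation factors and normal elements -/

theorem monom_mul_X (hq : IsMultAntisymm q) (ν : Fin n → ℕ) (j : Fin n) :
    monom q ν * X q j = (∏ k, q k j ^ ν k) • (X q j * monom q ν) := by
  have hp : ∀ k m, X q k ^ m * X q j = q k j ^ m • (X q j * X q k ^ m) := by
    intro k m
    induction m with
    | zero => simp
    | succ m ih =>
      rw [pow_succ', mul_assoc, ih, mul_smul_comm, ← mul_assoc, hq.X_mul_X, smul_mul_assoc,
        smul_smul, mul_assoc, pow_succ]
  have hl : ∀ l : List (Fin n), (l.map fun k => X q k ^ ν k).prod * X q j =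
      (l.map fun k => q k j ^ ν k).prod • (X q j * (l.map fun k => X q k ^ ν k).prod) := by
    intro l
    induction l with
    | nil => simp
    | cons k l ih =>
      simp only [List.map_cons, List.prod_cons]
      rw [mul_assoc, ih, mul_smul_comm, ← mul_assoc, hp, smul_mul_assoc, smul_smul, mul_assoc,
        mul_comm]
  rw [monom, List.ofFn_eq_map, hl, ← List.ofFn_eq_map, List.prod_ofFn]

/-- The linear map multiplying `x^ν` by `∏ k, q_kj ^ ν_k`. -/
noncomputable def twist (hq : IsMultAntisymm q) (j : Fin n) : Space q →ₗ[F] Space q :=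
  (monomBasis hq).constr F fun ν => (∏ k, q k j ^ ν k) • monom q ν

theorem twist_monom (hq : IsMultAntisymm q) (j : Fin n) (ν : Fin n → ℕ) :
    twist hq j (monom q ν) = (∏ k, q k j ^ ν k) • monom q ν := by
  rw [← monomBasis_apply hq, twist, Module.Basis.constr_basis, monomBasis_apply]

theorem mul_X_eq (hq : IsMultAntisymm q) (j : Fin n) (a : Space q) :
    a * X q j = X q j * twist hq j a := by
  have : LinearMap.mulRight F (X q j) = (LinearMap.mulLeft F (X q j)).comp (twist hq j) := by
    refine (monomBasis hq).ext fun ν => ?_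
    simp [twist_monom, monom_mul_X hq]
  simpa using LinearMap.congr_fun this a

theorem repr_twist (hq : IsMultAntisymm q) (j : Fin n) (a : Space q) (ν : Fin n → ℕ) :
    (monomBasis hq).repr (twist hq j a) ν = (∏ k, q k j ^ ν k) * (monomBasis hq).repr a ν := by
  have : ((monomBasis hq).coord ν).comp (twist hq j) =
      (∏ k, q k j ^ ν k) • (monomBasis hq).coord ν := by
    refine (monomBasis hq).ext fun μ => ?_
    by_cases h : μ = ν
    · subst h; simp [twist_monom, repr_monom]
    · simp [twist_monom, repr_monom, h]
  simpa using LinearMap.congr_fun this a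

/-- The exponents of `g * f = f * X_j` are exponents of `f` shifted by that of `X_j`. Comparing top
exponents bounds those of `g` above by the exponent of `X_j`, and comparing bottom exponents bounds
them below by it. -/
theorem eq_smul_X_of_mul_X_eq (hq : IsMultAntisymm q) {f g : Space q} {j : Fin n} (hf : f ≠ 0)
    (h : f * X q j = g * f) : ∃ c : F, g = c • X q j := by
  have hg : g ≠ 0 := by
    rintro rfl
    exact mul_ne_zero_of_ne_zero hq hf (X_ne_zero hq j) (by rw [h, zero_mul])
  have key : ∀ κ ∈ ((monomBasis hq).repr (g * f)).support,
      ∃ μ ∈ ((monomBasis hq).repr f).support, μ + Pi.single j 1 = κ := by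
    intro κ hκ
    rw [← h] at hκ
    obtain ⟨μ, hμ, ν, hν, rfl⟩ := exists_add_of_mem_support_mul hq hκ
    rw [repr_X] at hν
    exact ⟨μ, hμ, by rw [Finset.mem_singleton.1 (Finsupp.support_single_subset hν)]⟩
  obtain ⟨μ, hμ⟩ := exists_isTop hq hg
  obtain ⟨ν, hν⟩ := exists_isTop hq hf
  obtain ⟨μ', hμ'⟩ := exists_isBot hq hg
  obtain ⟨ν', hν'⟩ := exists_isBot hq hf
  obtain ⟨κ, hκ, e⟩ := key _ (hμ.add_mem hq hν)
  obtain ⟨κ', hκ', e'⟩ := key _ (hμ'.add_mem hq hν')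
  have h1 : toLex μ ≤ toLex (Pi.single j 1 : Fin n → ℕ) := by
    refine le_of_add_le_add_right (a := toLex ν) ?_
    rw [← toLex_add, ← e, toLex_add, add_comm]
    exact add_le_add_right (hν.2 _ hκ) _
  have h2 : toLex (Pi.single j 1 : Fin n → ℕ) ≤ toLex μ' := by
    refine le_of_add_le_add_right (a := toLex ν') ?_
    rw [← toLex_add μ', ← e', toLex_add κ', add_comm]
    exact add_le_add_left (hν'.2 _ hκ') _
  refine ⟨_, (eq_smul_monom_of_support hq fun η hη => ?_).trans (by rw [monom_single])⟩
  exact toLex.injective (le_antisymm ((hμ.2 _ hη).trans h1) (h2.trans (hμ'.2 _ hη)))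

/-- The exponents of an element normalizing `X_j` all have the same commutation factor
with `X_j`. -/
theorem prod_eq_of_mem_support (hq : IsMultAntisymm q) {f g : Space q} {j : Fin n}
    (h : f * X q j = g * f) {μ ν : Fin n → ℕ} (hμ : μ ∈ ((monomBasis hq).repr f).support)
    (hν : ν ∈ ((monomBasis hq).repr f).support) :
    ∏ k, q k j ^ μ k = ∏ k, q k j ^ ν k := by
  have hf : f ≠ 0 := by rintro rfl; simp at hμ
  obtain ⟨c, rfl⟩ := eq_smul_X_of_mul_X_eq hq hf h
  rw [mul_X_eq hq, smul_mul_assoc, ← mul_smul_comm, ← sub_eq_zero, ← mul_sub] at h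
  -- Cancelling `X_j` makes `f` an eigenvector of the diagonal map `twist`, so all its exponents
  -- have eigenvalue `c`.
  have h0 : twist hq j f = c • f := by
    by_contra h'
    exact mul_ne_zero_of_ne_zero hq (X_ne_zero hq j) (sub_ne_zero.2 h') h
  have key : ∀ κ ∈ ((monomBasis hq).repr f).support, ∏ k, q k j ^ κ k = c := by
    intro κ hκ
    have := congrArg (fun a => (monomBasis hq).repr a κ) h0
    simp only [repr_twist, map_smul, Finsupp.smul_apply, smul_eq_mul] at this
    exact mul_right_cancel₀ (Finsupp.mem_support_iff.1 hκ) this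
  rw [key _ hμ, key _ hν]

theorem prod_pow_single (i j : Fin n) :
    ∏ k, q k j ^ (Pi.single i 1 : Fin n → ℕ) k = q i j := by
  rw [Finset.prod_eq_single i]
  · simp
  · intro k _ hk; simp [hk]
  · simp

/-- An element all of whose exponents involve `X_i` is divisible by `X_i`. -/
theorem exists_eq_X_mul (hq : IsMultAntisymm q) {f : Space q} {i : Fin n}
    (h : ∀ ν ∈ ((monomBasis hq).repr f).support, ν i ≠ 0) : ∃ u, f = X q i * u := by
  have hf := (monomBasis hq).linearCombination_repr f
  rw [Finsupp.linearCombination_apply, Finsupp.sum] at hf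
  have hm : f ∈ LinearMap.range (LinearMap.mulLeft F (X q i)) := by
    rw [← hf]
    refine Submodule.sum_mem _ fun ν hν => Submodule.smul_mem _ _ ?_
    obtain ⟨c, hc, e⟩ := monom_mul_monom hq (Pi.single i 1) (ν - Pi.single i 1)
    have hν' : Pi.single i 1 + (ν - Pi.single i 1) = ν := by
      apply add_tsub_cancel_of_le
      intro j
      by_cases hj : j = i
      · subst hj; simpa [Nat.one_le_iff_ne_zero] using h ν hν
      · simp [hj]
    rw [hν', monom_single] at e
    refine ⟨c⁻¹ • monom q (ν - Pi.single i 1), ?_⟩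
    rw [LinearMap.mulLeft_apply, mul_smul_comm, e, smul_smul, inv_mul_cancel₀ hc, one_smul,
      monomBasis_apply]
  obtain ⟨u, hu⟩ := hm
  exact ⟨u, hu.symm⟩

/-! ### Linear parts of automorphisms -/

/-- The quotient of quantum affine space by the square of the augmentation ideal. -/
noncomputable def linearPart (q : Matrix (Fin n) (Fin n) F) :
    Space q →ₐ[F] TrivSqZeroExt F (Fin n → F) :=
  lift q (fun i => TrivSqZeroExt.inr (Pi.single i 1)) (by simp)

/-- Constants and monomials of degree at least two have no linear part, so coordinate `i` sees only
the coefficient of `X_i`. -/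
theorem repr_single_of_linearPart_ne_zero (hq : IsMultAntisymm q) {f : Space q} {i : Fin n}
    (h : (linearPart q f).snd i ≠ 0) : (monomBasis hq).repr f (Pi.single i 1) ≠ 0 := by
  contrapose! h
  have hfst : ∀ i, (linearPart q (X q i)).fst = 0 := by simp [linearPart]
  have hsnd : ∀ i, (linearPart q (X q i)).snd = Pi.single i 1 := by simp [linearPart]
  have key0 : ∀ ν, ν ≠ 0 → (linearPart q (monom q ν)).fst = 0 := by
    intro ν hν
    obtain ⟨j, hj⟩ := Function.ne_iff.1 hν
    obtain ⟨u, hu⟩ := exists_eq_X_mul hq (f := monom q ν) (i := j) (by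
      intro κ hκ
      rw [repr_monom] at hκ
      rw [Finset.mem_singleton.1 (Finsupp.support_single_subset hκ)]
      exact hj)
    rw [hu, map_mul, TrivSqZeroExt.fst_mul, hfst, zero_mul]
  have key : ∀ ν, ν ≠ Pi.single i 1 → (linearPart q (monom q ν)).snd i = 0 := by
    intro ν hν
    by_cases h0 : ν = 0
    · simp [h0, monom_zero]
    obtain ⟨j, hj⟩ := Function.ne_iff.1 h0
    have hν' : Pi.single j 1 + (ν - Pi.single j 1) = ν := by
      apply add_tsub_cancel_of_le
      intro k
      by_cases hk : k = j
      · subst hk; simpa [Nat.one_le_iff_ne_zero] using hj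
      · simp [hk]
    obtain ⟨c, hc, e⟩ := monom_mul_monom hq (Pi.single j 1) (ν - Pi.single j 1)
    rw [hν', monom_single] at e
    have e' : monom q ν = c⁻¹ • (X q j * monom q (ν - Pi.single j 1)) := by
      rw [e, smul_smul, inv_mul_cancel₀ hc, one_smul]
    rw [e', map_smul, map_mul, TrivSqZeroExt.snd_smul, TrivSqZeroExt.snd_mul, hfst, hsnd]
    by_cases h1 : ν - Pi.single j 1 = 0
    · rw [h1, add_zero] at hν'
      have hij : i ≠ j := by rintro rfl; exact hν hν'.symm
      simp [hij]
    · simp [key0 _ h1]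
  have hf := (monomBasis hq).linearCombination_repr f
  rw [Finsupp.linearCombination_apply, Finsupp.sum] at hf
  rw [← hf]
  simp only [map_sum, TrivSqZeroExt.snd_sum, Finset.sum_apply, map_smul, TrivSqZeroExt.snd_smul,
    Pi.smul_apply, monomBasis_apply, smul_eq_mul]
  refine Finset.sum_eq_zero fun ν _ => ?_
  by_cases hν : ν = Pi.single i 1
  · rw [hν, h, zero_mul]
  · rw [key ν hν, mul_zero]

/-- The image of a generator under an automorphism has a term of degree one. -/
theorem exists_single_mem_support (hq : IsMultAntisymm q) (φ : Space q ≃ₐ[F] Space q)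
    (i : Fin n) : ∃ a, Pi.single a 1 ∈ ((monomBasis hq).repr (φ (X q i))).support := by
  let L : Fin n → Fin n → F := fun j => (linearPart q (φ (X q j))).snd
  have hspan : ∀ a, (linearPart q (φ a)).snd ∈ Submodule.span F (Set.range L) := by
    intro a
    -- The linear part of a product is a combination of those of its factors, so the linear parts of
    -- the `φ(X_j)` span all linear parts. By surjectivity of `φ` they are `n` vectors spanning
    -- `F^n`, hence a basis, and none vanishes.
    refine space_induction ((Submodule.span F (Set.range L)).comap
      ((TrivSqZeroExt.sndHom F (Fin n → F)).comp
        ((linearPart q).comp (φ : Space q →ₐ[F] Space q)).toLinearMap)) ?_ ?_ a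
    · simp
    · intro j b hb
      simp only [Submodule.mem_comap, LinearMap.comp_apply, AlgHom.toLinearMap_apply,
        AlgHom.comp_apply, TrivSqZeroExt.sndHom_apply, map_mul, TrivSqZeroExt.snd_mul] at hb ⊢
      exact Submodule.add_mem _ (Submodule.smul_mem _ _ hb)
        (by rw [op_smul_eq_smul]; exact Submodule.smul_mem _ _ (Submodule.subset_span ⟨j, rfl⟩))
  have htop : ⊤ ≤ Submodule.span F (Set.range L) := by
    rw [← (Pi.basisFun F (Fin n)).span_eq, Submodule.span_le]
    rintro _ ⟨j, rfl⟩
    simpa [linearPart] using hspan (φ.symm (X q j))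
  have hL : L i ≠ 0 :=
    (linearIndependent_of_top_le_span_of_card_eq_finrank htop (by simp)).ne_zero i
  obtain ⟨a, ha⟩ := Function.ne_iff.1 hL
  exact ⟨a, Finsupp.mem_support_iff.2 (repr_single_of_linearPart_ne_zero hq ha)⟩

/-! ### The derivations and the condition `E = 0` -/

theorem monom_mul_X_of_mem_Lam (hq : IsMultAntisymm q) {i : Fin n} {ν : Fin n → ℕ}
    (hν : ν ∈ Lam q i) {j : Fin n} (hj : j ≠ i) :
    monom q ν * X q j = q i j • (X q j * monom q ν) := by
  rw [monom_mul_X hq, hν.2 j hj]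

theorem X_mul_monom_of_mem_Lam (hq : IsMultAntisymm q) {i : Fin n} {ν : Fin n → ℕ}
    (hν : ν ∈ Lam q i) {j : Fin n} (hj : j ≠ i) :
    X q j * monom q ν = q j i • (monom q ν * X q j) := by
  rw [monom_mul_X_of_mem_Lam hq hν hj, smul_smul, hq.symm_inv i j,
    inv_mul_cancel₀ (hq.ne_zero _ _), one_smul]

/-- For `ν ∈ Λ_i` the derivation `D_{iν}` exists. -/
theorem exists_isD (hq : IsMultAntisymm q) {i : Fin n} {ν : Fin n → ℕ} (hν : ν ∈ Lam q i) :
    ∃ D, IsD q i ν D := by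
  -- A derivation is the infinitesimal part of an algebra map `a ↦ a + ε D(a)` into the dual numbers
  -- over `O_q`. The relations hold for `y` because `x^ν` commutes with `X_j`, `j ≠ i`, exactly as
  -- `X_i` does.
  let y : Fin n → TrivSqZeroExt (Space q) (Space q) := fun j =>
    TrivSqZeroExt.inl (X q j) + TrivSqZeroExt.inr (if i = j then monom q ν else 0)
  have hyf : ∀ j, (y j).fst = X q j := fun j => by
    simp only [y, TrivSqZeroExt.fst_add, TrivSqZeroExt.fst_inl, TrivSqZeroExt.fst_inr, add_zero]
  have hys : ∀ j, (y j).snd = if i = j then monom q ν else 0 := fun j => by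
    simp only [y, TrivSqZeroExt.snd_add, TrivSqZeroExt.snd_inl, TrivSqZeroExt.snd_inr, zero_add]
  have hy : ∀ j k, j < k → y j * y k = q j k • (y k * y j) := by
    intro j k hjk
    ext
    · simpa [hyf] using hq.X_mul_X j k
    · by_cases hj : i = j
      · subst hj
        simpa [hyf, hys, hjk.ne] using monom_mul_X_of_mem_Lam hq hν hjk.ne'
      · by_cases hk : i = k
        · subst hk
          simpa [hyf, hys, hjk.ne'] using X_mul_monom_of_mem_Lam hq hν hjk.ne
        · simp [hyf, hys, hj, hk]
  let θ : Space q →ₐ[F] TrivSqZeroExt (Space q) (Space q) := lift q y hy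
  have hfst : ∀ a, (θ a).fst = a := by
    have : (TrivSqZeroExt.fstHom F (Space q) (Space q)).comp θ = AlgHom.id F _ := by
      apply algHom_ext
      intro j
      simp [θ, hyf]
    exact fun a => AlgHom.congr_fun this a
  refine ⟨(TrivSqZeroExt.sndHom (Space q) (Space q)).restrictScalars F ∘ₗ θ.toLinearMap, ?_, ?_⟩
  · intro a b
    simp [hfst, add_comm]
  · intro j
    simp [θ, hys]

theorem Lam_eq_empty (hq : IsMultAntisymm q) (hE : E q = ⊥) (i : Fin n) (ν : Fin n → ℕ) :
    ν ∉ Lam q i := by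
  intro hν
  obtain ⟨D, hD⟩ := exists_isD hq hν
  have h0 : D = 0 := Submodule.span_eq_bot.1 hE D ⟨i, ν, hν, hD⟩
  have h := hD.2 i
  rw [h0, if_pos rfl] at h
  exact (linearIndependent_monom hq).ne_zero ν h.symm

/-! ### Automorphisms when `E = 0` -/

/-- The generators are normal. -/
theorem exists_X_mul_eq (hq : IsMultAntisymm q) (i : Fin n) (b : Space q) :
    ∃ g, X q i * b = g * X q i := by
  have h : b ∈ (LinearMap.range (LinearMap.mulRight F (X q i))).comap
      (LinearMap.mulLeft F (X q i)) := by
    refine space_induction _ (Submodule.mem_comap.2 ?_) ?_ b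
    · exact ⟨1, (one_mul _).trans (mul_one _).symm⟩
    rintro k b ⟨g, hg⟩
    refine ⟨q i k • (X q k * g), ?_⟩
    simp only [LinearMap.mulRight_apply, LinearMap.mulLeft_apply] at hg ⊢
    rw [← mul_assoc, hq.X_mul_X i k, smul_mul_assoc, smul_mul_assoc, mul_assoc, mul_assoc, hg]
  obtain ⟨g, hg⟩ := h
  exact ⟨g, hg.symm⟩

/-- If `E = 0`, the exponents of the image of a generator all involve a common generator. -/
theorem exists_forall_mem_support_ne_zero (hq : IsMultAntisymm q) (hE : E q = ⊥)
    (φ : Space q ≃ₐ[F] Space q) (i : Fin n) :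
    ∃ a, Pi.single a 1 ∈ ((monomBasis hq).repr (φ (X q i))).support ∧
      ∀ ν ∈ ((monomBasis hq).repr (φ (X q i))).support, ν a ≠ 0 := by
  obtain ⟨a, ha⟩ := exists_single_mem_support hq φ i
  -- An exponent `ν` with `ν a = 0` would have the commutation factors of the linear term `X_a`,
  -- hence lie in `Λ_a`.
  refine ⟨a, ha, fun ν hν h0 => Lam_eq_empty hq hE a ν ⟨h0, fun j _ => ?_⟩⟩
  rw [← prod_pow_single (q := q) a j]
  obtain ⟨g, hg⟩ : ∃ g, φ (X q i) * X q j = g * φ (X q i) := by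
    obtain ⟨g, hg⟩ := exists_X_mul_eq hq i (φ.symm (X q j))
    exact ⟨φ g, by rw [← map_mul, ← hg, map_mul, φ.apply_symm_apply]⟩
  exact prod_eq_of_mem_support hq hg hν ha

/-- Write `φ(X_i) = X_a * u` and `φ⁻¹(X_a) = X_b * v`. Then `X_i = X_b * v * φ⁻¹(u)`, which forces
`b = i`; cancelling, `v * φ⁻¹(u) = 1`, so `v` is a scalar and hence so is `u`. -/
theorem exists_map_X_eq_smul (hq : IsMultAntisymm q) (hE : E q = ⊥)
    (φ : Space q ≃ₐ[F] Space q) (i : Fin n) :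
    ∃ a, (∃ c : Fˣ, φ (X q i) = (c : F) • X q a) := by
  have := nontrivial_space hq
  obtain ⟨a, -, ha⟩ := exists_forall_mem_support_ne_zero hq hE φ i
  obtain ⟨u, hu⟩ := exists_eq_X_mul hq ha
  obtain ⟨b, -, hb⟩ := exists_forall_mem_support_ne_zero hq hE φ.symm a
  obtain ⟨v, hv⟩ := exists_eq_X_mul hq hb
  have h : X q i = X q b * (v * φ.symm u) := by
    rw [← mul_assoc, ← hv, ← map_mul, ← hu, φ.symm_apply_apply]
  have hbi : b = i := by
    have hs : (Pi.single i 1 : Fin n → ℕ) ∈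
        ((monomBasis hq).repr (X q b * (v * φ.symm u))).support := by
      rw [← h, repr_X]; simp
    obtain ⟨μ, hμ, ν, -, e⟩ := exists_add_of_mem_support_mul hq hs
    rw [repr_X] at hμ
    rw [Finset.mem_singleton.1 (Finsupp.support_single_subset hμ)] at e
    by_contra hne
    simpa [hne] using congrFun e b
  subst hbi
  have h1 : v * φ.symm u = 1 := by
    by_contra hne
    refine mul_ne_zero_of_ne_zero hq (X_ne_zero hq b) (sub_ne_zero.2 hne) ?_
    rw [mul_sub, ← h, mul_one, sub_self]
  obtain ⟨c, rfl⟩ := eq_smul_one_of_mul_eq_one hq h1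
  have hc : c ≠ 0 := by rintro rfl; simp at h1
  have hu' : φ.symm u = c⁻¹ • 1 := by
    rw [← h1, smul_mul_assoc, one_mul, smul_smul, inv_mul_cancel₀ hc, one_smul]
  have hu'' : u = c⁻¹ • 1 := by
    rw [← φ.apply_symm_apply u, hu', map_smul, map_one]
  exact ⟨a, (Units.mk0 c hc)⁻¹, by rw [hu, hu'', mul_smul_comm, mul_one]; rfl⟩

theorem eq_of_smul_X_eq_smul_X (hq : IsMultAntisymm q) {i j : Fin n} {c d : F} (hc : c ≠ 0)
    (h : c • X q i = d • X q j) : i = j := by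
  have h' := congrArg (fun a => (monomBasis hq).repr a (Pi.single i 1)) h
  simp only [map_smul, repr_X, Finsupp.smul_apply, Finsupp.single_eq_same, smul_eq_mul,
    mul_one] at h'
  by_contra hij
  rw [Finsupp.single_eq_of_ne, mul_zero] at h'
  · exact hc h'
  · intro e
    simpa [hij] using congrFun e i

/-- If `E = 0`, an automorphism permutes the generators up to scalars. -/
theorem exists_perm (hq : IsMultAntisymm q) (hE : E q = ⊥) (φ : Space q ≃ₐ[F] Space q) :
    ∃ (σ : Equiv.Perm (Fin n)) (k : Fin n → Fˣ), (∀ i, φ (X q i) = (k i : F) • X q (σ i)) ∧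
      ∀ i j, q (σ i) (σ j) = q i j := by
  choose s k h using exists_map_X_eq_smul hq hE φ
  have hs : Function.Injective s := by
    intro i j hij
    -- If `s i = s j`, then `k_j X_i` and `k_i X_j` have the same image under `φ`.
    refine eq_of_smul_X_eq_smul_X hq (c := k j) (d := k i) (k j).ne_zero (φ.injective ?_)
    rw [map_smul, map_smul, h, h, hij, smul_smul, smul_smul, mul_comm]
  refine ⟨Equiv.ofBijective s (Finite.injective_iff_bijective.1 hs), k, h, fun i j => ?_⟩
  have h1 := congrArg φ (hq.X_mul_X i j)
  simp only [map_mul, map_smul, h, smul_mul_smul_comm, hq.X_mul_X (s i) (s j), smul_smul] at h1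
  have h2 := smul_left_injective F
    (mul_ne_zero_of_ne_zero hq (X_ne_zero hq (s j)) (X_ne_zero hq (s i))) h1
  have hi := (k i).ne_zero
  have hj := (k j).ne_zero
  change q (s i) (s j) = q i j
  refine mul_left_cancel₀ (mul_ne_zero hi hj) ?_
  rw [h2]
  ring

/-! ### Torus, permutation and elementary automorphisms -/

theorem torusHom_X (k : Fin n → Fˣ) (i : Fin n) : torusHom q k (X q i) = (k i : F) • X q i :=
  scale_X q k i

theorem torusHom_injective (hq : IsMultAntisymm q) : Function.Injective (torusHom q) := by
  intro k l h
  funext i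
  have h' := AlgEquiv.congr_fun h (X q i)
  rw [torusHom_X, torusHom_X] at h'
  exact Units.ext (smul_left_injective F (X_ne_zero hq i) h')

/-- The automorphism `X_i ↦ X_{σ i}` for a permutation `σ` preserving `q`. -/
noncomputable def permEquiv (hq : IsMultAntisymm q) (σ : Equiv.Perm (Fin n))
    (hσ : ∀ i j, q (σ i) (σ j) = q i j) : Space q ≃ₐ[F] Space q :=
  AlgEquiv.ofAlgHom
    (lift q (fun i => X q (σ i)) fun i j _ => by rw [hq.X_mul_X, hσ])
    (lift q (fun i => X q (σ.symm i)) fun i j _ => by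
      rw [hq.X_mul_X, ← hσ, σ.apply_symm_apply, σ.apply_symm_apply])
    (by apply algHom_ext; simp) (by apply algHom_ext; simp)

/-- The endomorphism `X_i ↦ X_i + t x^ν`, `X_j ↦ X_j` for `j ≠ i`. -/
noncomputable def elementary (hq : IsMultAntisymm q) {i : Fin n} {ν : Fin n → ℕ}
    (hν : ν ∈ Lam q i) (t : F) : Space q →ₐ[F] Space q :=
  lift q (fun j => X q j + if i = j then t • monom q ν else 0) fun j k hjk => by
    by_cases hj : i = j
    · subst hj
      simp only [if_true, if_neg hjk.ne, add_zero, add_mul, mul_add, smul_mul_assoc, smul_add,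
        mul_smul_comm, monom_mul_X_of_mem_Lam hq hν hjk.ne', hq.X_mul_X i k]
      rw [smul_comm t]
    · by_cases hk : i = k
      · subst hk
        simp only [if_true, if_neg hj, add_zero, add_mul, mul_add, smul_mul_assoc, smul_add,
          mul_smul_comm, X_mul_monom_of_mem_Lam hq hν hjk.ne, hq.X_mul_X j i]
        rw [smul_comm t]
      · simpa [hj, hk] using hq.X_mul_X j k

theorem elementary_X (hq : IsMultAntisymm q) {i : Fin n} {ν : Fin n → ℕ} (hν : ν ∈ Lam q i)
    (t : F) (j : Fin n) :
    elementary hq hν t (X q j) = X q j + if i = j then t • monom q ν else 0 :=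
  lift_X _ _ j

/-- Since `ν_i = 0`, the monomial `x^ν` does not involve the only generator that moves; this is why
`-t` gives the inverse. -/
theorem elementary_monom (hq : IsMultAntisymm q) {i : Fin n} {ν : Fin n → ℕ} (hν : ν ∈ Lam q i)
    (t : F) : elementary hq hν t (monom q ν) = monom q ν := by
  rw [monom, map_list_prod, List.map_ofFn]
  congr 2
  funext j
  by_cases hj : i = j
  · subst hj; simp [hν.1]
  · simp [elementary_X, hj]

theorem elementary_comp (hq : IsMultAntisymm q) {i : Fin n} {ν : Fin n → ℕ} (hν : ν ∈ Lam q i)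
    (s t : F) (h : s + t = 0) :
    (elementary hq hν s).comp (elementary hq hν t) = AlgHom.id F _ := by
  apply algHom_ext
  intro j
  by_cases hj : i = j
  · subst hj
    simp [elementary_X, elementary_monom, add_assoc, ← add_smul, h]
  · simp [elementary_X, hj]

/-- For `ν ∈ Λ_i`, there is an automorphism outside the torus. -/
theorem not_autEqTorus_of_mem_Lam (hq : IsMultAntisymm q) {i : Fin n} {ν : Fin n → ℕ}
    (hν : ν ∈ Lam q i) : ¬ AutEqTorus q := by
  intro h
  obtain ⟨k, hk⟩ := h.2 (AlgEquiv.ofAlgHom (elementary hq hν 1) (elementary hq hν (-1))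
    (elementary_comp hq hν _ _ (by simp)) (elementary_comp hq hν _ _ (by simp)))
  have h1 := AlgEquiv.congr_fun hk (X q i)
  rw [torusHom_X, AlgEquiv.ofAlgHom_apply, elementary_X, if_pos rfl, one_smul] at h1
  have h2 := congrArg (fun a => (monomBasis hq).repr a ν) h1
  have hne : (Pi.single i 1 : Fin n → ℕ) ≠ ν := by
    rintro rfl
    simpa using hν.1
  simp [repr_X, repr_monom, hne] at h2

/-- The automorphism group of `O_q` is the torus if and only if `E = 0` and no non-identity
permutation of the indices preserves `q`. -/
theorem autEqTorus_iff (hq : IsMultAntisymm q) : AutEqTorus q ↔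
    E q = ⊥ ∧ ∀ σ : Equiv.Perm (Fin n), (∀ i j, q (σ i) (σ j) = q i j) → σ = 1 := by
  constructor
  · intro h
    refine ⟨Submodule.span_eq_bot.2 ?_, fun σ hσ => ?_⟩
    · rintro D ⟨i, ν, hν, -⟩
      exact absurd h (not_autEqTorus_of_mem_Lam hq hν)
    · obtain ⟨k, hk⟩ := h.2 (permEquiv hq σ hσ)
      refine Equiv.ext fun i => ?_
      have h1 := AlgEquiv.congr_fun hk (X q i)
      rw [torusHom_X, permEquiv, AlgEquiv.ofAlgHom_apply, lift_X, ← one_smul F (X q (σ i))] at h1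
      exact (eq_of_smul_X_eq_smul_X hq (k i).ne_zero h1).symm
  · rintro ⟨hE, hperm⟩
    refine ⟨torusHom_injective hq, fun φ => ?_⟩
    obtain ⟨σ, k, h, hσ⟩ := exists_perm hq hE φ
    obtain rfl := hperm σ hσ
    refine ⟨k, ?_⟩
    have h' : (torusHom q k : Space q →ₐ[F] Space q) = φ := by
      apply algHom_ext
      intro i
      exact (torusHom_X k i).trans (h i).symm
    exact AlgEquiv.ext fun a => AlgHom.congr_fun h' a

/-! ### Permutations preserving `q` -/

theorem mul_permMatrix_eq_iff {ι : Type*} [Fintype ι] [DecidableEq ι] (p : Matrix ι ι F)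
    (σ : Equiv.Perm ι) :
    p * σ.permMatrix F = σ.permMatrix F * p ↔ ∀ i j, p (σ i) (σ j) = p i j := by
  -- The entries are compared at `(i, σ j)`, where the two products are `p i j` and `p (σ i) (σ j)`.
  rw [← Matrix.ext_iff, forall_congr' fun i => σ.symm.forall_congr_left]
  refine forall₂_congr fun i j => ?_
  simp [Equiv.Perm.permMatrix, PEquiv.toMatrix_toPEquiv_mul, PEquiv.mul_toMatrix_toPEquiv,
    eq_comm]

/-- If `E = 0`, the rows of `q` are distinct. -/
theorem row_injective (hq : IsMultAntisymm q) (hE : E q = ⊥) : Function.Injective q := by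
  intro a b hab
  by_contra hne
  refine Lam_eq_empty hq hE a (Pi.single b 1) ⟨by simp [hne], fun j _ => ?_⟩
  rw [prod_pow_single, hab]

end QuantumAffine

theorem theorem1 {F : Type*} [Field F] [CharZero F] {n : ℕ} (hn : 3 ≤ n)
    (q : Matrix (Fin n) (Fin n) F) (hq : QuantumAffine.IsMultAntisymm q)
    (hone : ∀ i j k l : Fin n, i < j → k < l → q i j = 1 → q k l = 1 → i = k ∧ j = l) :
    ((∀ i j : Fin n, i < j → q i j ≠ 1) →
      (QuantumAffine.AutEqTorus q ↔
        QuantumAffine.E q = ⊥ ∧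
        ¬ ∃ σ : Equiv.Perm (Fin n), σ ≠ 1 ∧
          q * σ.permMatrix F = σ.permMatrix F * q)) ∧
    (∀ i' j' : Fin n, ∀ _hij : i' < j', q i' j' = 1 →
      (QuantumAffine.AutEqTorus q ↔
        QuantumAffine.E q = ⊥ ∧
        ¬ ∃ (π₁ : Equiv.Perm ({i', j'} : Finset (Fin n)))
            (π₂ : Equiv.Perm (({i', j'} : Finset (Fin n))ᶜ : Finset (Fin n))),
          π₂ ≠ 1 ∧
          (∀ r : (({i', j'} : Finset (Fin n))ᶜ : Finset (Fin n)),
            q i' r = q (π₁ ⟨i', by simp⟩) (π₂ r) ∧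
            q j' r = q (π₁ ⟨j', by simp⟩) (π₂ r)) ∧
          q.submatrix Subtype.val Subtype.val * π₂.permMatrix F =
            π₂.permMatrix F * q.submatrix Subtype.val Subtype.val)) := by
  refine ⟨fun _ => ?_, fun i' j' hij h1 => ?_⟩
  · rw [QuantumAffine.autEqTorus_iff hq]
    refine and_congr_right fun _ => ?_
    simp only [QuantumAffine.mul_permMatrix_eq_iff, not_exists, not_and']
    exact forall₂_congr fun σ _ => not_not.symm
  · rw [QuantumAffine.autEqTorus_iff hq]
    refine and_congr_right fun hE => ?_
    have hS : ∀ a b : Fin n, a ≠ b → q a b = 1 → a = i' ∧ b = j' ∨ a = j' ∧ b = i' := by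
      intro a b hab h
      rcases lt_or_gt_of_ne hab with hlt | hlt
      · exact Or.inl (hone _ _ _ _ hlt hij h h1)
      · have := hone _ _ _ _ hlt hij (by rw [hq.symm_inv a b, h, inv_one]) h1
        exact Or.inr ⟨this.2, this.1⟩
    have h1' : q j' i' = 1 := by rw [hq.symm_inv i' j', h1, inv_one]
    constructor
    · rintro hperm ⟨π₁, π₂, hne, hr, hm⟩
      rw [QuantumAffine.mul_permMatrix_eq_iff] at hm
      let σ : Equiv.Perm (Fin n) := Equiv.Perm.ofSubtype π₁ * Equiv.Perm.ofSubtype π₂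
      have hσ₁ : ∀ x : ({i', j'} : Finset (Fin n)), σ x = π₁ x := by
        intro x
        rw [Equiv.Perm.mul_apply, Equiv.Perm.ofSubtype_apply_of_not_mem π₂ (fun h => Finset.mem_compl.1 h x.2),
          Equiv.Perm.ofSubtype_apply_coe]
      have hσ₂ : ∀ x : (({i', j'} : Finset (Fin n))ᶜ : Finset (Fin n)), σ x = π₂ x := by
        intro x
        rw [Equiv.Perm.mul_apply, Equiv.Perm.ofSubtype_apply_coe,
          Equiv.Perm.ofSubtype_apply_of_not_mem π₁ (Finset.mem_compl.1 (π₂ x).2)]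
      -- All entries of the block on `{i', j'}` are `1`, so any `π₁` preserves it.
      have hone₁ : ∀ x y : ({i', j'} : Finset (Fin n)), q x y = 1 := by
        rintro ⟨x, hx⟩ ⟨y, hy⟩
        simp only [Finset.mem_insert, Finset.mem_singleton] at hx hy
        rcases hx with rfl | rfl <;> rcases hy with rfl | rfl <;> simp [h1, h1', hq.diag]
      have hmix : ∀ (x : ({i', j'} : Finset (Fin n)))
          (y : (({i', j'} : Finset (Fin n))ᶜ : Finset (Fin n))), q (π₁ x) (π₂ y) = q x y := by
        rintro ⟨x, hx⟩ y
        have hx' := hx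
        simp only [Finset.mem_insert, Finset.mem_singleton] at hx'
        rcases hx' with rfl | rfl
        · exact (hr y).1.symm
        · exact (hr y).2.symm
      have hσ1 : σ = 1 := by
        refine hperm σ fun i j => ?_
        by_cases hi : i ∈ ({i', j'} : Finset (Fin n)) <;>
          by_cases hj : j ∈ ({i', j'} : Finset (Fin n))
        · rw [hσ₁ ⟨i, hi⟩, hσ₁ ⟨j, hj⟩, hone₁, hone₁ ⟨i, hi⟩ ⟨j, hj⟩]
        · rw [hσ₁ ⟨i, hi⟩, hσ₂ ⟨j, Finset.mem_compl.2 hj⟩, hmix]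
        · rw [hσ₂ ⟨i, Finset.mem_compl.2 hi⟩, hσ₁ ⟨j, hj⟩, hq.symm_inv (π₁ ⟨j, hj⟩), hmix,
            ← hq.symm_inv]
        · rw [hσ₂ ⟨i, Finset.mem_compl.2 hi⟩, hσ₂ ⟨j, Finset.mem_compl.2 hj⟩]
          exact hm ⟨i, _⟩ ⟨j, _⟩
      refine hne (Equiv.ext fun x => Subtype.ext ?_)
      rw [← hσ₂, hσ1]
      rfl
    · intro hno σ hσ
      -- A permutation preserving `q` must preserve the only off-diagonal position, up to
      -- transposition, with entry `1`.
      have hi : σ i' = i' ∧ σ j' = j' ∨ σ i' = j' ∧ σ j' = i' :=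
        hS _ _ (σ.injective.ne hij.ne) (by rw [hσ, h1])
      have hmem : ∀ x, σ x ∈ ({i', j'} : Finset (Fin n)) ↔ x ∈ ({i', j'} : Finset (Fin n)) := by
        intro x
        have hx : ∀ y, σ x = σ y ↔ x = y := fun y => σ.injective.eq_iff
        have hxi := hx i'
        have hxj := hx j'
        simp only [Finset.mem_insert, Finset.mem_singleton]
        rcases hi with ⟨ha, hb⟩ | ⟨ha, hb⟩ <;> rw [ha] at hxi <;> rw [hb] at hxj <;>
          tauto
      have hmem' : ∀ x, σ x ∈ ({i', j'} : Finset (Fin n))ᶜ ↔ x ∈ ({i', j'} : Finset (Fin n))ᶜ := by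
        intro x
        rw [Finset.mem_compl, Finset.mem_compl, hmem]
      have hπ₂ : σ.subtypePerm hmem' = 1 := by
        by_contra hne
        refine hno ⟨σ.subtypePerm hmem, σ.subtypePerm hmem', hne, ?_, ?_⟩
        · intro r
          exact ⟨(hσ _ _).symm, (hσ _ _).symm⟩
        · rw [QuantumAffine.mul_permMatrix_eq_iff]
          exact fun i j => hσ _ _
      have hfix : ∀ x, x ∉ ({i', j'} : Finset (Fin n)) → σ x = x := by
        intro x hx
        exact congrArg Subtype.val (Equiv.ext_iff.1 hπ₂ ⟨x, Finset.mem_compl.2 hx⟩)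
      rcases hi with ⟨ha, hb⟩ | ⟨ha, hb⟩
      · refine Equiv.ext fun x => ?_
        by_cases hx : x ∈ ({i', j'} : Finset (Fin n))
        · simp only [Finset.mem_insert, Finset.mem_singleton] at hx
          rcases hx with rfl | rfl
          · exact ha
          · exact hb
        · exact hfix x hx
      -- If `σ` swaps `i'` and `j'` and fixes everything else, rows `i'` and `j'` of `q` coincide,
      -- which `E = 0` forbids. Hence only `π₂` has to be required non-identity.
      · refine absurd (QuantumAffine.row_injective hq hE (funext fun x => ?_)) hij.ne
        by_cases hx : x ∈ ({i', j'} : Finset (Fin n))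
        · simp only [Finset.mem_insert, Finset.mem_singleton] at hx
          rcases hx with rfl | rfl
          · rw [hq.diag, h1']
          · rw [h1, hq.diag]
        · rw [← hσ i' x, ha, hfix x hx]
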